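/- There is an absolute constant $c>0$ such that the following holds. Let $0<\varepsilon\le 1/8$ and let $n,k$ be integers with $0<k\le n-1$. Call a probability distribution $p$ on $\{-1,1\}^n$ a junta distribution over $J\subseteq[n]$ if its probability mass function $p(x)$ depends only on the variables $x_i$, $i\in J$, and a $k$-junta distribution if it is a junta distribution over some $J$ with $|J|\le k$. Consider a randomized adaptive algorithm with general conditional query access to an unknown distribution $p$: each query is an arbitrary set $A\subseteq\{-1,1\}^n$, possibly depending on the previous answers and on internal randomness, and it is answered by a fresh sample $x\sim p$ conditioned on $x\in A$ (if $p(A)=0$, the answer is drawn from any fixed distribution on $\{-1,1\}^n$ that depends only on $A$, for instance the uniform distribution on $A$ when $A\neq\emptyset$). Suppose that, for every $k$-junta distribution $p$ on $\{-1,1\}^n$, with probability at least $4/5$ the algorithm outputs a set $J\subseteq[n]$ with $|J|\le k$ such that $p$ is $\varepsilon$-close to a junta distribution over $J$, that is, $d_{\mathrm{TV}}(p,g)=\frac12\sum_{x}|p(x)-g(x)|\le\varepsilon$ for some junta distribution $g$ over $J$. Suppose also that, for every $k$-junta distribution $p$, every execution of positive probability makes at most $q$ queries. Then $$q\;\ge\;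 c\cdot\frac{\log\binom nk}{\varepsilon^2}.$$ -/

import Mathlib

open scoped ENNReal

noncomputable section

namespace JuntaLearning

/-- The hypercube `{-1,1}^n`; the units of `ℤ` are exactly `1` and `-1`. -/
abbrev Cube (n : ℕ) : Type := Fin n → ℤˣ

/-- `p` is a junta distribution over `J`: its probability mass function depends only on the
variables in `J`. -/
def IsJuntaOver {n : ℕ} (J : Finset (Fin n)) (p : PMF (Cube n)) : Prop :=
  DependsOn (fun x => p x) (J : Set (Fin n))

/-- `p` is a `k`-junta distribution: its probability mass function depends on at most `k`
variables. -/
def IsKJunta {n : ℕ} (k : ℕ) (p : PMF (Cube n)) : Prop :=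
  ∃ J : Finset (Fin n), J.card ≤ k ∧ IsJuntaOver J p

/-- Total variation distance of two distributions on the hypercube. -/
def tvDist {n : ℕ} (p g : PMF (Cube n)) : ℝ :=
  (1 / 2) * ∑ x, |(p x).toReal - (g x).toReal|

/-- `p` is `ε`-close to some junta distribution over `J`. -/
def CloseToJuntaOver {n : ℕ} (ε : ℝ) (J : Finset (Fin n)) (p : PMF (Cube n)) : Prop :=
  ∃ g : PMF (Cube n), IsJuntaOver J g ∧ tvDist p g ≤ ε

/-- A convention for the oracle's answer to a query `A` that has probability zero under the
unknown distribution. The uniform distribution on `A` is one such convention. Pointing to an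
element outside `A` is another, which tells the algorithm that the query failed. -/
abbrev ZeroMassConvention (n : ℕ) : Type := Set (Cube n) → PMF (Cube n)

open scoped Classical in
/-- The general conditional sampling oracle for `p`: on a query `A ⊆ {-1,1}^n` with `p(A) > 0` it
returns a sample from `p` conditioned on `A`; if `p(A) = 0` it follows the convention `z`. -/
def condOracle {n : ℕ} (z : ZeroMassConvention n) (p : PMF (Cube n)) (A : Set (Cube n)) :
    PMF (Cube n) :=
  if h : ∃ x ∈ A, x ∈ p.support then p.filter A h else z A

/-- A deterministic adaptive algorithm with conditional query access: it stops with an output set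
of variables, or queries a set `A` and continues depending on the sample it receives. -/
inductive QueryTree (n : ℕ) : Type
  | output (J : Finset (Fin n)) : QueryTree n
  | query (A : Set (Cube n)) (next : Cube n → QueryTree n) : QueryTree n

/-- The joint law of the output and of the number of queries made, when the deterministic algorithm
is run with fresh independent answers drawn from the oracle `O`. -/
def QueryTree.run {n : ℕ} (O : Set (Cube n) → PMF (Cube n)) :
    QueryTree n → PMF (Finset (Fin n) × ℕ)
  | .output J => PMF.pure (J, 0)
  | .query A next => (O A).bind fun x => ((next x).run O).map fun r => (r.1, r.2 + 1)

/-- A randomized algorithm: a distribution over deterministic ones. -/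
abbrev Algorithm (n : ℕ) : Type := PMF (QueryTree n)

/-- The joint law of the output and of the number of queries made by a randomized algorithm. -/
def Algorithm.run {n : ℕ} (𝒜 : Algorithm n) (O : Set (Cube n) → PMF (Cube n)) :
    PMF (Finset (Fin n) × ℕ) :=
  PMF.bind 𝒜 fun T => T.run O

/-- On every `k`-junta distribution, with probability at least `4/5` the algorithm outputs a set
`J` of at most `k` variables such that the distribution is `ε`-close to a junta distribution
over `J`. -/
def Algorithm.FindsRelevantVariables {n : ℕ} (𝒜 : Algorithm n) (z : ZeroMassConvention n)
    (k : ℕ) (ε : ℝ) : Prop :=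
  ∀ p : PMF (Cube n), IsKJunta k p →
    (4 / 5 : ℝ≥0∞) ≤ (Algorithm.run 𝒜 (condOracle z p)).toOuterMeasure
      {r | r.1.card ≤ k ∧ CloseToJuntaOver ε r.1 p}

/-- On every `k`-junta distribution, every execution of positive probability makes at most `q`
queries. -/
def Algorithm.MakesAtMost {n : ℕ} (𝒜 : Algorithm n) (z : ZeroMassConvention n)
    (k q : ℕ) : Prop :=
  ∀ p : PMF (Cube n), IsKJunta k p →
    ∀ r ∈ (Algorithm.run 𝒜 (condOracle z p)).support, r.2 ≤ q

end JuntaLearning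

end

/-!
The hard instances are the distributions with density `1 + δ χ_J` with respect to the uniform
distribution, where `χ_J` is the parity of `J` and `|J| = k`. For `δ > 2ε` such a distribution is
more than `ε`-far from every junta distribution over a set that does not contain `J`, so on it the
algorithm has to output exactly `J`.

The likelihood ratio to the uniform distribution lies in `[1 - δ, 1 + δ]`, and conditioning on a
query only rescales it. By Kantorovich's inequality its second moment after conditioning is
therefore at most `1 / (1 - δ²)`, whatever the query. Second moments of likelihood ratios are
submultiplicative along adaptive processes, so if `P_J` and `Q` are the laws of the output on the
instance `J` and on the uniform distribution, then `P_J(J)² / Q(J) ≤ (1 - δ²)^(-q)`. Some `J` has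
`Q(J) ≤ 1 / (n.choose k)` while `P_J(J) ≥ 4/5`; take logarithms and let `δ` decrease to `2ε`.
-/

noncomputable section

namespace JuntaLearning

section SecondMoment

variable {α β : Type*}

lemma sq_tsum_div_tsum_le_tsum_sq_div (x y : α → ℝ≥0∞) :
    (∑' i, x i) ^ 2 / ∑' i, y i ≤ ∑' i, x i ^ 2 / y i := by
  by_cases hS : ∑' i, x i ^ 2 / y i = ∞
  · simp [hS]
  by_cases hY : ∑' i, y i = ∞
  · simp [hY]
  have hx (i : α) : x i = (x i ^ 2 / y i) ^ (1 / 2 : ℝ) * y i ^ (1 / 2 : ℝ) := by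
    have hy (h : y i = 0) : x i ^ 2 = 0 := by
      by_contra hxi
      exact ENNReal.ne_top_of_tsum_ne_top hS i (by rw [h, ENNReal.div_zero hxi])
    rw [← ENNReal.mul_rpow_of_nonneg _ _ (by norm_num),
      ENNReal.div_mul_cancel' hy fun h => absurd h (ENNReal.ne_top_of_tsum_ne_top hY i),
      ← ENNReal.rpow_natCast, ← ENNReal.rpow_mul]
    simp
  have hHolder : ∑' i, x i ≤
      (∑' i, x i ^ 2 / y i) ^ (1 / 2 : ℝ) * (∑' i, y i) ^ (1 / 2 : ℝ) := by
    let _ : MeasurableSpace α := ⊤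
    have h := ENNReal.lintegral_mul_norm_pow_le (μ := MeasureTheory.Measure.count)
      (f := fun i => x i ^ 2 / y i) (g := y) measurable_from_top.aemeasurable
      measurable_from_top.aemeasurable (p := 1 / 2) (q := 1 / 2)
      (by norm_num) (by norm_num) (by norm_num)
    simpa only [MeasureTheory.lintegral_count, ← hx] using h
  refine ENNReal.div_le_of_le_mul ?_
  calc (∑' i, x i) ^ 2
      ≤ ((∑' i, x i ^ 2 / y i) ^ (1 / 2 : ℝ) * (∑' i, y i) ^ (1 / 2 : ℝ)) ^ 2 := by gcongr
    _ = (∑' i, x i ^ 2 / y i) * ∑' i, y i := by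
        rw [← ENNReal.mul_rpow_of_nonneg _ _ (by norm_num), ← ENNReal.rpow_natCast,
          ← ENNReal.rpow_mul]
        simp

/-- The second moment of the likelihood ratio `p / q` under `q`, that is, `1 + χ²(p ‖ q)`. Since
`ℝ≥0∞` has `0 / 0 = 0` and `a / 0 = ∞` for `a ≠ 0`, it is infinite unless `p` is absolutely
continuous with respect to `q`. -/
def secondMoment (p q : PMF α) : ℝ≥0∞ := ∑' a, p a ^ 2 / q a

lemma one_le_secondMoment (p q : PMF α) : 1 ≤ secondMoment p q := by
  simpa only [secondMoment, PMF.tsum_coe, one_pow, div_one] using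
    sq_tsum_div_tsum_le_tsum_sq_div p q

lemma secondMoment_self (p : PMF α) : secondMoment p p = 1 := by
  have h (a : α) : p a ^ 2 / p a = p a := by
    rw [sq, mul_div_assoc]
    rcases eq_or_ne (p a) 0 with h0 | h0
    · simp [h0]
    · rw [ENNReal.div_self h0 (p.apply_ne_top a), mul_one]
  simp only [secondMoment, h, PMF.tsum_coe]

lemma secondMoment_bind_le {p q : PMF α} {f g : α → PMF β} {C : ℝ≥0∞}
    (h : ∀ a ∈ p.support, secondMoment (f a) (g a) ≤ C) :
    secondMoment (p.bind f) (q.bind g) ≤ secondMoment p q * C := by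
  calc secondMoment (p.bind f) (q.bind g)
      ≤ ∑' b, ∑' a, (p a * f a b) ^ 2 / (q a * g a b) :=
        ENNReal.tsum_le_tsum fun b => sq_tsum_div_tsum_le_tsum_sq_div _ _
    _ = ∑' a, p a ^ 2 / q a * secondMoment (f a) (g a) := by
        rw [ENNReal.tsum_comm]
        refine tsum_congr fun a => ?_
        rw [secondMoment, ← ENNReal.tsum_mul_left]
        refine tsum_congr fun b => ?_
        rw [mul_pow, ENNReal.mul_div_mul_comm (.inr (PMF.apply_ne_top _ _))
          (.inl (PMF.apply_ne_top _ _))]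
    _ ≤ ∑' a, p a ^ 2 / q a * C := by
        refine ENNReal.tsum_le_tsum fun a => ?_
        by_cases ha : p a = 0
        · simp [ha]
        · gcongr
          exact h a ha
    _ = secondMoment p q * C := ENNReal.tsum_mul_right

lemma secondMoment_map_le (f : α → β) (p q : PMF α) :
    secondMoment (p.map f) (q.map f) ≤ secondMoment p q := by
  simpa only [← PMF.bind_pure_comp, Function.comp_def, mul_one] using
    secondMoment_bind_le (q := q) fun a _ => (secondMoment_self (PMF.pure (f a))).le

lemma four_mul_le_add_sq (x y : ℝ≥0∞) : 4 * (x * y) ≤ (x + y) ^ 2 := by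
  wlog h : x ≤ y generalizing x y
  · simpa only [mul_comm, add_comm] using this y x (le_of_not_ge h)
  obtain ⟨d, rfl⟩ := exists_add_of_le h
  calc 4 * (x * (x + d)) ≤ 4 * (x * (x + d)) + d ^ 2 := le_self_add
    _ = (x + (x + d)) ^ 2 := by ring

-- This is `0 ≤ (s - a * t) * (b * t - s) / t`, expanded so that no subtraction occurs.
lemma sq_div_add_mul_le {a b s t : ℝ≥0∞} (ht : t ≠ ∞) (ha : a * t ≤ s) (hb : s ≤ b * t) :
    s ^ 2 / t + a * b * t ≤ (a + b) * s := by
  rcases eq_or_ne t 0 with rfl | ht0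
  · simp_all
  obtain ⟨r, rfl⟩ : ∃ r, s = r * t := ⟨s / t, (ENNReal.div_mul_cancel ht0 ht).symm⟩
  rw [ENNReal.mul_le_mul_iff_left ht0 ht] at ha hb
  obtain ⟨d, rfl⟩ := exists_add_of_le hb
  calc (r * t) ^ 2 / t + a * (r + d) * t
      = (r ^ 2 + a * r + a * d) * t := by
        rw [mul_pow, sq t, ← mul_assoc, ENNReal.mul_div_cancel_right ht0 ht]
        ring
    _ ≤ (r ^ 2 + a * r + r * d) * t := by gcongr
    _ = (a + (r + d)) * (r * t) := by ring

lemma four_mul_secondMoment_le {a b : ℝ≥0∞} {p q : PMF α} (ha : ∀ x, a * q x ≤ p x)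
    (hb : ∀ x, p x ≤ b * q x) : 4 * (a * b * secondMoment p q) ≤ (a + b) ^ 2 := by
  have h : secondMoment p q + a * b ≤ a + b := by
    simpa only [secondMoment, ENNReal.tsum_add, ENNReal.tsum_mul_left, PMF.tsum_coe, mul_one] using
      ENNReal.tsum_le_tsum fun x => sq_div_add_mul_le (q.apply_ne_top x) (ha x) (hb x)
  calc 4 * (a * b * secondMoment p q)
      ≤ (a * b + secondMoment p q) ^ 2 := four_mul_le_add_sq _ _
    _ ≤ (a + b) ^ 2 := by rw [add_comm (a * b)]; gcongr

-- Conditioning multiplies the likelihood ratio by a constant on `A`, and the resulting bound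
-- `(a + b) ^ 2 / (4 * a * b)` depends only on the quotient `b / a`.
lemma four_mul_secondMoment_filter_le {a b : ℝ≥0∞} {p q : PMF α} (ha : ∀ x, a * q x ≤ p x)
    (hb : ∀ x, p x ≤ b * q x) {A : Set α} (hp : ∃ x ∈ A, x ∈ p.support)
    (hq : ∃ x ∈ A, x ∈ q.support) :
    4 * (a * b * secondMoment (p.filter A hp) (q.filter A hq)) ≤ (a + b) ^ 2 := by
  set P := ∑' x, A.indicator p x with hP
  set Q := ∑' x, A.indicator q x with hQ
  have hmass {r : PMF α} (hr : ∃ x ∈ A, x ∈ r.support) :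
      ∑' x, A.indicator r x ≠ 0 ∧ ∑' x, A.indicator r x ≠ ∞ := by
    obtain ⟨x, hxA, hx⟩ := hr
    refine ⟨fun h => hx ?_, r.tsum_coe_indicator_ne_top A⟩
    simpa [hxA] using ENNReal.tsum_eq_zero.mp h x
  have hQP : Q * P⁻¹ ≠ 0 ∧ Q * P⁻¹ ≠ ∞ := by
    simp [ENNReal.mul_eq_top, hP, hQ, hmass hp, hmass hq]
  have hscale (c : ℝ≥0∞) (x : α) :
      c * (Q * P⁻¹) * q.filter A hq x = A.indicator (fun y => c * q y) x * P⁻¹ := by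
    rw [PMF.filter_apply, Set.indicator_const_mul, ← hQ]
    calc c * (Q * P⁻¹) * (A.indicator q x * Q⁻¹) = c * A.indicator q x * P⁻¹ * (Q * Q⁻¹) := by ring
      _ = c * A.indicator q x * P⁻¹ := by
        rw [ENNReal.mul_inv_cancel (hmass hq).1 (hmass hq).2, mul_one]
  have hscaled := four_mul_secondMoment_le (a := a * (Q * P⁻¹)) (b := b * (Q * P⁻¹))
    (p := p.filter A hp) (q := q.filter A hq)
    (fun x => by rw [hscale, PMF.filter_apply]; gcongr; exact ha _)
    (fun x => by rw [hscale, PMF.filter_apply]; gcongr; exact hb _)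
  rw [← ENNReal.mul_le_mul_iff_left (pow_ne_zero 2 hQP.1) (ENNReal.pow_ne_top hQP.2)]
  convert hscaled using 1 <;> ring

lemma exists_mem_apply_le_inv_card (p : PMF α) {S : Finset α} (hS : S.Nonempty) :
    ∃ a ∈ S, p a ≤ (S.card : ℝ≥0∞)⁻¹ := by
  by_contra! h
  have hlt : ∑ _a ∈ S, (S.card : ℝ≥0∞)⁻¹ < ∑ a ∈ S, p a := ENNReal.sum_lt_sum_of_nonempty hS h
  rw [Finset.sum_const, nsmul_eq_mul, ENNReal.mul_inv_cancel (by simpa using hS.ne_empty)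
    (ENNReal.natCast_ne_top _)] at hlt
  exact hlt.not_ge ((ENNReal.sum_le_tsum S).trans_eq p.tsum_coe)

end SecondMoment

section ChangeOfOracle

variable {n : ℕ} {O O' : Set (Cube n) → PMF (Cube n)} {B : ℝ≥0∞}

lemma QueryTree.secondMoment_run_le (hB : ∀ A, secondMoment (O A) (O' A) ≤ B) (T : QueryTree n)
    {q : ℕ} (hq : ∀ r ∈ (T.run O).support, r.2 ≤ q) :
    secondMoment (T.run O) (T.run O') ≤ B ^ q := by
  induction T generalizing q with
  | output J =>
    rw [QueryTree.run, QueryTree.run, secondMoment_self]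
    exact one_le_pow₀ ((one_le_secondMoment _ _).trans (hB ∅))
  | query A next ih =>
    have hstep : ∀ x ∈ (O A).support, ∀ r ∈ ((next x).run O).support, r.2 + 1 ≤ q :=
      fun x hx r hr => hq (r.1, r.2 + 1) <| (PMF.mem_support_bind_iff _ _ _).mpr
        ⟨x, hx, (PMF.mem_support_map_iff _ _ _).mpr ⟨r, hr, rfl⟩⟩
    obtain ⟨m, rfl⟩ : ∃ m, q = m + 1 := by
      obtain ⟨x, hx⟩ := (O A).support_nonempty
      obtain ⟨r, hr⟩ := ((next x).run O).support_nonempty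
      exact Nat.exists_eq_add_of_le' (Nat.le_of_add_left_le (hstep x hx r hr))
    rw [QueryTree.run, QueryTree.run, pow_succ']
    refine (secondMoment_bind_le fun x hx => ?_).trans (mul_le_mul_left (hB A) _)
    exact (secondMoment_map_le _ _ _).trans
      (ih x fun r hr => Nat.le_of_succ_le_succ (hstep x hx r hr))

/-- The law of the output of a randomized algorithm, without the number of queries. -/
def Algorithm.outputLaw (𝒜 : Algorithm n) (O : Set (Cube n) → PMF (Cube n)) :
    PMF (Finset (Fin n)) :=
  (Algorithm.run 𝒜 O).map Prod.fst

lemma Algorithm.secondMoment_outputLaw_le (hB : ∀ A, secondMoment (O A) (O' A) ≤ B)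
    {𝒜 : Algorithm n} {q : ℕ} (hq : ∀ r ∈ (Algorithm.run 𝒜 O).support, r.2 ≤ q) :
    secondMoment (Algorithm.outputLaw 𝒜 O) (Algorithm.outputLaw 𝒜 O') ≤ B ^ q := by
  calc secondMoment (Algorithm.outputLaw 𝒜 O) (Algorithm.outputLaw 𝒜 O')
      ≤ secondMoment (Algorithm.run 𝒜 O) (Algorithm.run 𝒜 O') := secondMoment_map_le _ _ _
    _ ≤ secondMoment 𝒜 𝒜 * B ^ q := secondMoment_bind_le fun T hT =>
        T.secondMoment_run_le hB fun r hr =>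
          hq r ((PMF.mem_support_bind_iff _ _ _).mpr ⟨T, hT, hr⟩)
    _ = B ^ q := by rw [secondMoment_self, one_mul]

lemma four_mul_secondMoment_condOracle_le {a b : ℝ≥0∞} {p q : PMF (Cube n)}
    (ha : ∀ x, a * q x ≤ p x) (hb : ∀ x, p x ≤ b * q x) (z : ZeroMassConvention n)
    (A : Set (Cube n)) :
    4 * (a * b * secondMoment (condOracle z p A) (condOracle z q A)) ≤ (a + b) ^ 2 := by
  rcases eq_or_ne a 0 with rfl | ha0
  · simp
  have hsupp : p.support = q.support := by
    ext x
    simp only [PMF.mem_support_iff, not_iff_not]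
    refine ⟨fun hx => ?_, fun hx => ?_⟩
    · simpa [hx, ha0] using ha x
    · simpa [hx] using hb x
  by_cases hp : ∃ x ∈ A, x ∈ p.support
  · have hq : ∃ x ∈ A, x ∈ q.support := hsupp ▸ hp
    rw [condOracle, condOracle, dif_pos hp, dif_pos hq]
    exact four_mul_secondMoment_filter_le ha hb hp hq
  · rw [condOracle, condOracle, dif_neg hp, dif_neg (hsupp ▸ hp), secondMoment_self, mul_one]
    exact four_mul_le_add_sq a b

end ChangeOfOracle

section TiltedParity

variable {n : ℕ}

/-- The Fourier character `χ_J(x) = ∏_{i ∈ J} x_i` of the hypercube. -/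
def parity (J : Finset (Fin n)) (x : Cube n) : ℝ := ((∏ i ∈ J, x i : ℤˣ) : ℤ)

lemma abs_parity (J : Finset (Fin n)) (x : Cube n) : |parity J x| = 1 := by
  rcases Int.units_eq_one_or (∏ i ∈ J, x i) with h | h <;> simp [parity, h]

lemma parity_mul_mulSingle {J : Finset (Fin n)} {i : Fin n} (hi : i ∈ J) (x : Cube n) :
    parity J (x * Pi.mulSingle i (-1)) = -parity J x := by
  simp [parity, Finset.prod_mul_distrib, hi, -Units.coe_prod]

lemma sum_parity {J : Finset (Fin n)} (hJ : J.Nonempty) : ∑ x, parity J x = 0 := by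
  obtain ⟨i, hi⟩ := hJ
  have h := Equiv.sum_comp (Equiv.mulRight (Pi.mulSingle i (-1) : Cube n)) (parity J)
  simp only [Equiv.coe_mulRight, parity_mul_mulSingle hi, Finset.sum_neg_distrib] at h
  linarith

lemma IsJuntaOver.apply_mul_mulSingle {J : Finset (Fin n)} {g : PMF (Cube n)}
    (hg : IsJuntaOver J g) {i : Fin n} (hi : i ∉ J) (u : ℤˣ) (x : Cube n) :
    g (x * Pi.mulSingle i u) = g x :=
  hg fun j hj => by simp [ne_of_mem_of_not_mem hj hi]

lemma sum_abs_sub_mul_mulSingle_le_tvDist {J : Finset (Fin n)} {g : PMF (Cube n)}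
    (hg : IsJuntaOver J g) {i : Fin n} (hi : i ∉ J) (u : ℤˣ) (p : PMF (Cube n)) :
    ∑ x, |(p x).toReal - (p (x * Pi.mulSingle i u)).toReal| ≤ 4 * tvDist p g := by
  have hinv : ∑ x, |(g x).toReal - (p (x * Pi.mulSingle i u)).toReal| =
      ∑ x, |(p x).toReal - (g x).toReal| := by
    rw [← Equiv.sum_comp (Equiv.mulRight (Pi.mulSingle i u : Cube n))
      fun x => |(p x).toReal - (g x).toReal|]
    simp only [Equiv.coe_mulRight, hg.apply_mul_mulSingle hi, abs_sub_comm]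
  have htri : ∑ x, |(p x).toReal - (p (x * Pi.mulSingle i u)).toReal| ≤
      ∑ x, |(p x).toReal - (g x).toReal| +
        ∑ x, |(g x).toReal - (p (x * Pi.mulSingle i u)).toReal| := by
    rw [← Finset.sum_add_distrib]
    exact Finset.sum_le_sum fun x _ => abs_sub_le _ _ _
  rw [hinv] at htri
  rw [tvDist]
  linarith

lemma one_add_mul_parity_mem_Icc (δ : ℝ) (J : Finset (Fin n)) (x : Cube n) :
    1 + δ * parity J x ∈ Set.Icc (1 - |δ|) (1 + |δ|) := by
  have h : |δ * parity J x| = |δ| := by rw [abs_mul, abs_parity, mul_one]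
  constructor <;> linarith [neg_abs_le (δ * parity J x), le_abs_self (δ * parity J x)]

lemma one_add_mul_parity_nonneg {δ : ℝ} (hδ : |δ| ≤ 1) (J : Finset (Fin n)) (x : Cube n) :
    0 ≤ 1 + δ * parity J x :=
  (sub_nonneg.mpr hδ).trans (one_add_mul_parity_mem_Icc δ J x).1

/-- The uniform distribution on the hypercube tilted by the parity of `J`, with density
`1 + δ χ_J`. These are the hard instances of the lower bound. -/
def tiltedParity (δ : ℝ) (hδ : |δ| ≤ 1) (J : Finset (Fin n)) (hJ : J.Nonempty) : PMF (Cube n) :=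
  PMF.ofFintype (fun x => ENNReal.ofReal ((1 + δ * parity J x) / 2 ^ n)) <| by
    rw [← ENNReal.ofReal_sum_of_nonneg fun x _ =>
        div_nonneg (one_add_mul_parity_nonneg hδ J x) (by positivity),
      ← Finset.sum_div, Finset.sum_add_distrib, ← Finset.mul_sum, sum_parity hJ]
    simp

variable {δ : ℝ} {hδ : |δ| ≤ 1} {J : Finset (Fin n)} {hJ : J.Nonempty}

lemma tiltedParity_toReal (x : Cube n) :
    (tiltedParity δ hδ J hJ x).toReal = (1 + δ * parity J x) / 2 ^ n :=
  ENNReal.toReal_ofReal (div_nonneg (one_add_mul_parity_nonneg hδ J x) (by positivity))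

lemma isJuntaOver_tiltedParity : IsJuntaOver J (tiltedParity δ hδ J hJ) := by
  intro x y hxy
  have : parity J x = parity J y := by
    rw [parity, parity, Finset.prod_congr rfl hxy]
  simp [tiltedParity, this]

lemma ofReal_mul_uniformOfFintype (c : ℝ) (x : Cube n) :
    ENNReal.ofReal c * PMF.uniformOfFintype (Cube n) x = ENNReal.ofReal (c / 2 ^ n) := by
  rw [ENNReal.ofReal_div_of_pos (by positivity), div_eq_mul_inv]
  simp [PMF.uniformOfFintype_apply]

lemma secondMoment_condOracle_tiltedParity_le (hδ1 : |δ| < 1) (z : ZeroMassConvention n)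
    (A : Set (Cube n)) :
    secondMoment (condOracle z (tiltedParity δ hδ J hJ) A)
      (condOracle z (PMF.uniformOfFintype (Cube n)) A) ≤ ENNReal.ofReal (1 - δ ^ 2)⁻¹ := by
  have hlo (x : Cube n) : ENNReal.ofReal (1 - |δ|) * PMF.uniformOfFintype (Cube n) x ≤
      tiltedParity δ hδ J hJ x := by
    rw [ofReal_mul_uniformOfFintype]
    refine ENNReal.ofReal_le_ofReal ?_
    exact div_le_div_of_nonneg_right (one_add_mul_parity_mem_Icc δ J x).1 (by positivity)
  have hhi (x : Cube n) : tiltedParity δ hδ J hJ x ≤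
      ENNReal.ofReal (1 + |δ|) * PMF.uniformOfFintype (Cube n) x := by
    rw [ofReal_mul_uniformOfFintype]
    refine ENNReal.ofReal_le_ofReal ?_
    exact div_le_div_of_nonneg_right (one_add_mul_parity_mem_Icc δ J x).2 (by positivity)
  have hpos : 0 < 1 - δ ^ 2 := sub_pos.mpr ((sq_lt_one_iff_abs_lt_one δ).mpr hδ1)
  have hsum : ENNReal.ofReal (1 - |δ|) + ENNReal.ofReal (1 + |δ|) = 2 := by
    rw [← ENNReal.ofReal_add (by linarith) (by positivity)]
    norm_num
  have hprod : ENNReal.ofReal (1 - |δ|) * ENNReal.ofReal (1 + |δ|) =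
      ENNReal.ofReal (1 - δ ^ 2) := by
    rw [← ENNReal.ofReal_mul (by linarith), ← sq_abs δ]
    ring_nf
  have h := four_mul_secondMoment_condOracle_le hlo hhi z A
  rw [hsum, hprod, show (2 : ℝ≥0∞) ^ 2 = 4 * 1 by norm_num,
    ENNReal.mul_le_mul_iff_right (by norm_num) (by norm_num)] at h
  rwa [ENNReal.ofReal_inv_of_pos hpos, ENNReal.le_inv_iff_mul_le, mul_comm]

lemma abs_div_two_le_tvDist_tiltedParity {J' : Finset (Fin n)} {g : PMF (Cube n)}
    (hg : IsJuntaOver J' g) (hJJ' : ¬J ⊆ J') : |δ| / 2 ≤ tvDist (tiltedParity δ hδ J hJ) g := by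
  obtain ⟨i, hi, hi'⟩ := Finset.not_subset.mp hJJ'
  have hdiff (x : Cube n) : |(tiltedParity δ hδ J hJ x).toReal -
      (tiltedParity δ hδ J hJ (x * Pi.mulSingle i (-1))).toReal| = 2 * |δ| / 2 ^ n := by
    rw [tiltedParity_toReal, tiltedParity_toReal, parity_mul_mulSingle hi, ← sub_div,
      show 1 + δ * parity J x - (1 + δ * -parity J x) = 2 * δ * parity J x by ring]
    simp [abs_div, abs_mul, abs_parity]
  have h := sum_abs_sub_mul_mulSingle_le_tvDist hg hi' (-1) (tiltedParity δ hδ J hJ)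
  simp only [hdiff, Finset.sum_const, Finset.card_univ, nsmul_eq_mul] at h
  have hcard : (Fintype.card (Cube n) : ℝ) = 2 ^ n := by simp
  rw [hcard, mul_div_cancel₀ _ (by positivity)] at h
  linarith

lemma CloseToJuntaOver.subset_of_tiltedParity {ε : ℝ} {J' : Finset (Fin n)}
    (h : CloseToJuntaOver ε J' (tiltedParity δ hδ J hJ)) (hε : ε < |δ| / 2) : J ⊆ J' := by
  obtain ⟨g, hg, hdist⟩ := h
  by_contra hJJ'
  exact absurd (abs_div_two_le_tvDist_tiltedParity hg hJJ') (hdist.trans_lt hε).not_ge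

end TiltedParity

section LowerBound

variable {n k q : ℕ} {ε δ : ℝ} {z : ZeroMassConvention n} {𝒜 : Algorithm n}

lemma Algorithm.FindsRelevantVariables.le_outputLaw_tiltedParity
    (h𝒜 : Algorithm.FindsRelevantVariables 𝒜 z k ε) (hδ : |δ| ≤ 1) (hε : ε < |δ| / 2)
    {J : Finset (Fin n)} (hJ : J.Nonempty) (hcard : J.card = k) :
    4 / 5 ≤ Algorithm.outputLaw 𝒜 (condOracle z (tiltedParity δ hδ J hJ)) J := by
  rw [← PMF.toOuterMeasure_apply_singleton, Algorithm.outputLaw, PMF.toOuterMeasure_map_apply]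
  refine (h𝒜 _ ⟨J, hcard.le, isJuntaOver_tiltedParity⟩).trans (MeasureTheory.measure_mono ?_)
  rintro r ⟨hr, hclose⟩
  exact (Finset.eq_of_subset_of_card_le (hclose.subset_of_tiltedParity hε)
    (hr.trans hcard.ge)).symm

lemma Algorithm.choose_le_pow_of_findsRelevantVariables
    (h𝒜 : Algorithm.FindsRelevantVariables 𝒜 z k ε) (hq : Algorithm.MakesAtMost 𝒜 z k q)
    (hδ : |δ| < 1) (hε : ε < |δ| / 2) (hk : k ≠ 0) (hkn : k ≤ n) :
    16 / 25 * (n.choose k : ℝ) ≤ (1 - δ ^ 2)⁻¹ ^ q := by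
  obtain ⟨J, hJ, hJle⟩ := exists_mem_apply_le_inv_card
    (Algorithm.outputLaw 𝒜 (condOracle z (PMF.uniformOfFintype (Cube n))))
    (S := Finset.univ.powersetCard k) (Finset.powersetCard_nonempty.mpr (by simpa using hkn))
  rw [Finset.card_powersetCard, Finset.card_univ, Fintype.card_fin] at hJle
  have hcard : J.card = k := (Finset.mem_powersetCard.mp hJ).2
  have hJne : J.Nonempty := Finset.card_ne_zero.mp (hcard ▸ hk)
  have hfind := h𝒜.le_outputLaw_tiltedParity hδ.le hε hJne hcard
  have hmoment := Algorithm.secondMoment_outputLaw_le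
    (secondMoment_condOracle_tiltedParity_le (hJ := hJne) (hδ := hδ.le) hδ z)
    (hq _ ⟨J, hcard.le, isJuntaOver_tiltedParity⟩)
  have hpos : 0 ≤ (1 - δ ^ 2)⁻¹ :=
    inv_nonneg.mpr (sub_nonneg.mpr ((sq_lt_one_iff_abs_lt_one δ).mpr hδ).le)
  have h : (4 / 5 : ℝ≥0∞) ^ 2 * n.choose k ≤ ENNReal.ofReal ((1 - δ ^ 2)⁻¹ ^ q) := by
    rw [ENNReal.ofReal_pow hpos]
    refine (le_trans ?_ (ENNReal.le_tsum J)).trans hmoment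
    rw [div_eq_mul_inv _ (Algorithm.outputLaw _ _ _)]
    gcongr
    exact ENNReal.le_inv_iff_le_inv.mpr hJle
  have h' := ENNReal.toReal_mono ENNReal.ofReal_ne_top h
  have hleft : ((4 / 5 : ℝ≥0∞) ^ 2 * n.choose k).toReal = 16 / 25 * n.choose k := by
    norm_num [ENNReal.toReal_div]
  rwa [hleft, ENNReal.toReal_ofReal (by positivity)] at h'

lemma log_div_four_le_log {N : ℝ} (hN : 2 ≤ N) : Real.log N / 4 ≤ Real.log (16 / 25 * N) := by
  have hcube : 2 ^ 3 ≤ N ^ 3 := by gcongr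
  have h : Real.log N ≤ Real.log ((16 / 25 * N) ^ 4) :=
    Real.log_le_log (by positivity) (by nlinarith)
  rw [Real.log_pow] at h
  push_cast at h
  linarith

lemma Algorithm.log_choose_le_of_findsRelevantVariables
    (h𝒜 : Algorithm.FindsRelevantVariables 𝒜 z k ε) (hq : Algorithm.MakesAtMost 𝒜 z k q)
    (hδ : |δ| < 1) (hε : ε < |δ| / 2) (hchoose : 2 ≤ n.choose k) :
    (1 - δ ^ 2) * (Real.log (n.choose k) / 4) ≤ q * δ ^ 2 := by
  have hk : k ≠ 0 := by
    rintro rfl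
    simp at hchoose
  have hkn : k ≤ n := by
    by_contra! h
    simp [Nat.choose_eq_zero_of_lt h] at hchoose
  have hpos : 0 < 1 - δ ^ 2 := sub_pos.mpr ((sq_lt_one_iff_abs_lt_one δ).mpr hδ)
  rw [← le_div_iff₀' hpos]
  calc Real.log (n.choose k) / 4
      ≤ Real.log (16 / 25 * n.choose k) := log_div_four_le_log (by exact_mod_cast hchoose)
    _ ≤ Real.log ((1 - δ ^ 2)⁻¹ ^ q) := Real.log_le_log (by positivity)
        (Algorithm.choose_le_pow_of_findsRelevantVariables h𝒜 hq hδ hε hk hkn)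
    _ ≤ q * ((1 - δ ^ 2)⁻¹ - 1) := by
        rw [Real.log_pow]
        gcongr
        exact Real.log_le_sub_one_of_pos (by positivity)
    _ = q * δ ^ 2 / (1 - δ ^ 2) := by
        field_simp
        ring

end LowerBound

end JuntaLearning

end

open Filter Topology in
theorem theorem3_general {n k q : ℕ} {ε : ℝ} (hε : 0 < ε) (hε' : ε < 1 / 2) (hkn : k ≤ n)
    {z : JuntaLearning.ZeroMassConvention n} {𝒜 : JuntaLearning.Algorithm n}
    (h𝒜 : JuntaLearning.Algorithm.FindsRelevantVariables 𝒜 z k ε)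
    (hq : JuntaLearning.Algorithm.MakesAtMost 𝒜 z k q) :
    (1 - 4 * ε ^ 2) / 16 * (Real.log (n.choose k : ℝ) / ε ^ 2) ≤ q := by
  rcases (Nat.choose_pos hkn).nat_succ_le.eq_or_lt with hone | hchoose
  · simp [← hone]
  -- The tilt `δ = 2 * ε` itself is not allowed: the uniform distribution is then at distance `ε`.
  have hδ : ∀ᶠ δ in 𝓝[>] (2 * ε), (1 - δ ^ 2) * (Real.log (n.choose k) / 4) ≤ q * δ ^ 2 := by
    filter_upwards [Ioo_mem_nhdsGT (show 2 * ε < 1 by linarith)] with δ ⟨hδ, hδ'⟩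
    have habs : |δ| = δ := abs_of_pos (by linarith)
    exact JuntaLearning.Algorithm.log_choose_le_of_findsRelevantVariables h𝒜 hq
      (by rwa [habs]) (by linarith) hchoose
  have hlim {f : ℝ → ℝ} (hf : Continuous f) : Tendsto f (𝓝[>] (2 * ε)) (𝓝 (f (2 * ε))) :=
    hf.continuousWithinAt
  have h := le_of_tendsto_of_tendsto (hlim (by fun_prop)) (hlim (by fun_prop)) hδ
  rw [← mul_div_assoc, div_le_iff₀ (by positivity)]
  linarith

theorem theorem3 :
    ∃ c : ℝ, 0 < c ∧
      ∀ (n k : ℕ) (ε : ℝ), 0 < ε → ε ≤ 1 / 8 → 0 < k → k < n →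
      ∀ (z : JuntaLearning.ZeroMassConvention n) (𝒜 : JuntaLearning.Algorithm n) (q : ℕ),
        JuntaLearning.Algorithm.FindsRelevantVariables 𝒜 z k ε →
        JuntaLearning.Algorithm.MakesAtMost 𝒜 z k q →
        c * (Real.log (n.choose k : ℝ) / ε ^ 2) ≤ (q : ℝ) := by
  exact ⟨15 / 256, by norm_num, fun n k ε hε hε' _ hkn z 𝒜 q h𝒜 hq =>
    (mul_le_mul_of_nonneg_right (by nlinarith) (by positivity)).trans
      (theorem3_general hε (by linarith) hkn.le h𝒜 hq)⟩
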